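/- A \emph{fullerene graph} is a finite connected simple cubic plane graph each of whose faces has length 5 or 6. Two distinct faces are neighbours if they share an edge, and the \emph{facial distance} of two faces is their distance in the dual graph (so neighbouring faces are at facial distance 1). A \emph{drum} is a fullerene graph with two specified 6-faces $F$ and $F'$, each of which is a neighbour of six 5-faces, such that these twelve 5-faces are all distinct. For a non-negative integer $k$, a \emph{$k$-drum} is a drum in which $F$ and $F'$ are at facial distance $k+1$. Proposition. Let $G$ be a $k$-drum with specified 6-faces $F$ and $F'$. Then for every integer $\ell$ with $0\le \ell\le k$, all faces of $G$ at facial distance $\ell$ from $F$ have the same length. -/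

import Mathlib

/-- A rotation system on a graph: a permutation of the darts (oriented edges) which, around
each vertex `v`, permutes the darts with origin `v` in one single cycle. Rotation systems are
the combinatorial description of the cellular embeddings of `G` in oriented surfaces. -/
structure RotationSystem {V : Type*} (G : SimpleGraph V) where
  /-- the next dart around the origin of a dart -/
  rot : Equiv.Perm G.Dart
  rot_fst : ∀ d : G.Dart, (rot d).fst = d.fst
  rot_sameCycle : ∀ d e : G.Dart, d.fst = e.fst → rot.SameCycle d e

namespace RotationSystem

/-- Face tracing: traverse the dart `d`, then continue with the dart that comes after the
reversed dart in the rotation at the endpoint of `d`. -/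
def facePerm {V : Type*} {G : SimpleGraph V} (R : RotationSystem G) : Equiv.Perm G.Dart :=
  (Function.Involutive.toPerm SimpleGraph.Dart.symm SimpleGraph.Dart.symm_involutive).trans R.rot

/-- The faces of the embedding: the orbits of face tracing. -/
def Face {V : Type*} {G : SimpleGraph V} (R : RotationSystem G) : Type _ :=
  Quotient (Equiv.Perm.SameCycle.setoid R.facePerm)

/-- The face that is traced by a dart. -/
def faceOf {V : Type*} {G : SimpleGraph V} (R : RotationSystem G) (d : G.Dart) : R.Face :=
  Quotient.mk (Equiv.Perm.SameCycle.setoid R.facePerm) d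

/-- The length of a face: the number of darts on its boundary walk. -/
noncomputable def faceLength {V : Type*} {G : SimpleGraph V} (R : RotationSystem G)
    (f : R.Face) : ℕ :=
  {d : G.Dart | R.faceOf d = f}.ncard

/-- The (simple) dual graph: two distinct faces are neighbours when they share an edge. -/
def dual {V : Type*} {G : SimpleGraph V} (R : RotationSystem G) : SimpleGraph R.Face where
  Adj f g := f ≠ g ∧ ∃ d : G.Dart, R.faceOf d = f ∧ R.faceOf d.symm = g
  symm := ⟨fun _ _ h => ⟨h.1.symm, h.2.elim fun d hd =>
    ⟨d.symm, hd.2, by rw [SimpleGraph.Dart.symm_symm]; exact hd.1⟩⟩⟩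
  loopless := ⟨fun _ h => h.1 rfl⟩

/-- The facial distance: the distance in the dual graph, so that distinct faces that share an
edge are at distance `1`. -/
noncomputable def facialDist {V : Type*} {G : SimpleGraph V} (R : RotationSystem G)
    (f g : R.Face) : ℕ :=
  R.dual.dist f g

/-- The rotation system of a finite connected graph (with at least one edge) describes an
embedding in the sphere, that is, a plane graph: its Euler characteristic is `2`. -/
def IsPlane {V : Type*} {G : SimpleGraph V} (R : RotationSystem G) : Prop :=
  G.Connected ∧ (Nat.card V : ℤ) - (Nat.card G.edgeSet : ℤ) + (Nat.card R.Face : ℤ) = 2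

/-- A fullerene graph, with its plane embedding: a (connected) cubic plane graph each of whose
faces is of length `5` or `6`. -/
structure IsFullerene {V : Type*} [Fintype V] {G : SimpleGraph V} [DecidableRel G.Adj]
    (R : RotationSystem G) : Prop where
  plane : R.IsPlane
  cubic : G.IsRegularOfDegree 3
  faceLength_eq : ∀ f : R.Face, R.faceLength f = 5 ∨ R.faceLength f = 6

/-- The set of the `5`-faces that are neighbours of the face `F`. -/
def fiveFacesAround {V : Type*} {G : SimpleGraph V} (R : RotationSystem G) (F : R.Face) :
    Set R.Face :=
  {f | R.dual.Adj F f ∧ R.faceLength f = 5}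

/-- A drum with distinguished faces `F` and `F'`: a fullerene graph in which `F` and `F'` are
`6`-faces, each of them is a neighbour of six `5`-faces, and these twelve `5`-faces are
distinct. -/
structure IsDrum {V : Type*} [Fintype V] {G : SimpleGraph V} [DecidableRel G.Adj]
    (R : RotationSystem G) (F F' : R.Face) : Prop where
  fullerene : R.IsFullerene
  length_left : R.faceLength F = 6
  length_right : R.faceLength F' = 6
  card_left : (R.fiveFacesAround F).ncard = 6
  card_right : (R.fiveFacesAround F').ncard = 6
  disjoint : Disjoint (R.fiveFacesAround F) (R.fiveFacesAround F')

/-- A `k`-drum: a drum whose distinguished faces are at facial distance `k + 1`. -/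
structure IsKDrum {V : Type*} [Fintype V] {G : SimpleGraph V} [DecidableRel G.Adj]
    (R : RotationSystem G) (k : ℕ) (F F' : R.Face) : Prop where
  drum : R.IsDrum F F'
  dist_eq : R.facialDist F F' = k + 1

end RotationSystem

namespace RotationSystem

variable {V : Type*} {G : SimpleGraph V} (R : RotationSystem G)

/-! By Euler's formula a fullerene has exactly twelve 5-faces, so in a drum every 5-face is a
neighbour of `F` or `F'`. A 5-face at positive distance `l ≤ k` from `F` therefore has `l = 1`, or
touches `F'` and has `l = k`. All neighbours of `F` are 5-faces, so only `l = k ≥ 2` needs work: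
there no 6-face may accompany a 5-face.

Around `F` lies a ring of pentagons (ring 0), then rings of hexagons; `ringDart` follows their outer
boundaries. Ring `m` is within distance `m + 1` of `F`, so before ring `k - 1` a pentagon can only
be a neighbour of `F`, that is, a face of ring 0; `faceOf_ringDart_succ_ne` excludes this by showing
that rings never fold back. Hence the faces at distance `k` all lie in ring `k - 1`
(`exists_ringDart_of_dist`). One of them touches `F'`, and contact with `F'` spreads along the ring
(`faceLength_ringDart_succ_eq_five`), so all are pentagons. -/

theorem facePerm_apply (d : G.Dart) : R.facePerm d = R.rot d.symm := rfl

theorem faceOf_eq_iff {d e : G.Dart} : R.faceOf d = R.faceOf e ↔ R.facePerm.SameCycle d e :=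
  Quotient.eq

theorem faceOf_facePerm (d : G.Dart) : R.faceOf (R.facePerm d) = R.faceOf d :=
  R.faceOf_eq_iff.2 (Equiv.Perm.sameCycle_apply_left.2 (Equiv.Perm.SameCycle.refl _ _))

theorem faceOf_facePerm_zpow (i : ℤ) (d : G.Dart) :
    R.faceOf ((R.facePerm ^ i) d) = R.faceOf d :=
  R.faceOf_eq_iff.2 (Equiv.Perm.sameCycle_zpow_left.2 (Equiv.Perm.SameCycle.refl _ _))

theorem faceOf_surjective (f : R.Face) : ∃ d, R.faceOf d = f := Quotient.exists_rep f

theorem faceOf_rot (d : G.Dart) : R.faceOf (R.rot d) = R.faceOf d.symm := by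
  have := R.faceOf_facePerm d.symm
  rwa [facePerm_apply, SimpleGraph.Dart.symm_symm] at this

theorem dual_adj_of_ne {d : G.Dart} (h : R.faceOf d ≠ R.faceOf d.symm) :
    R.dual.Adj (R.faceOf d) (R.faceOf d.symm) := ⟨h, d, rfl, rfl⟩

/-! ### Connectedness of the dual graph -/

theorem dual_reachable_symm (d : G.Dart) :
    R.dual.Reachable (R.faceOf d) (R.faceOf d.symm) := by
  by_cases h : R.faceOf d = R.faceOf d.symm
  · rw [h]
  · exact (R.dual_adj_of_ne h).reachable

theorem dual_reachable_rot_pow (n : ℕ) (d : G.Dart) :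
    R.dual.Reachable (R.faceOf d) (R.faceOf ((R.rot ^ n) d)) := by
  induction n with
  | zero => rfl
  | succ n ih =>
    rw [pow_succ', Equiv.Perm.mul_apply, faceOf_rot]
    exact ih.trans (R.dual_reachable_symm _)

theorem dual_reachable_of_fst_eq [Finite V] {d e : G.Dart} (h : d.fst = e.fst) :
    R.dual.Reachable (R.faceOf d) (R.faceOf e) := by
  classical
  have := Fintype.ofFinite V
  obtain ⟨n, _, hn⟩ := (R.rot_sameCycle d e h).exists_pow_eq'
  exact hn ▸ R.dual_reachable_rot_pow n d

theorem dual_reachable_of_reachable [Finite V] {u v : V} (h : G.Reachable u v) :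
    ∀ d e : G.Dart, d.fst = u → e.fst = v → R.dual.Reachable (R.faceOf d) (R.faceOf e) := by
  obtain ⟨w⟩ := h
  induction w with
  | nil => exact fun d e hd he => R.dual_reachable_of_fst_eq (hd.trans he.symm)
  | @cons u v _ h _ ih =>
    intro d e hd he
    let c : G.Dart := ⟨(u, v), h⟩
    exact (R.dual_reachable_of_fst_eq (e := c) hd).trans
      ((R.dual_reachable_symm c).trans (ih c.symm e rfl he))

theorem dual_preconnected [Finite V] (hG : G.Connected) : R.dual.Preconnected := by
  intro f g
  obtain ⟨d, rfl⟩ := R.faceOf_surjective f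
  obtain ⟨e, rfl⟩ := R.faceOf_surjective g
  exact R.dual_reachable_of_reachable (hG.preconnected d.fst e.fst) d e rfl rfl

/-! ### Periods of face tracing and of the rotation -/

theorem minimalPeriod_eq_faceLength [Finite V] (d : G.Dart) :
    Function.minimalPeriod R.facePerm d = R.faceLength (R.faceOf d) := by
  classical
  have := Fintype.ofFinite V
  have h := MulAction.minimalPeriod_eq_card (a := R.facePerm) (b := d)
  have hset : {e : G.Dart | R.faceOf e = R.faceOf d} =
      MulAction.orbit (Subgroup.zpowers R.facePerm) d := by
    ext e
    rw [Set.mem_ofPred_eq, eq_comm, faceOf_eq_iff]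
    constructor
    · rintro ⟨i, rfl⟩
      exact ⟨⟨R.facePerm ^ i, i, rfl⟩, rfl⟩
    · rintro ⟨⟨_, i, rfl⟩, rfl⟩
      exact ⟨i, rfl⟩
  rw [faceLength, hset, Set.ncard_eq_toFinset_card', Set.toFinset_card]
  exact h

theorem iterate_faceLength [Finite V] {d : G.Dart} {n : ℕ}
    (h : R.faceLength (R.faceOf d) = n) : R.facePerm^[n] d = d := by
  rw [← h, ← minimalPeriod_eq_faceLength]
  exact Function.iterate_minimalPeriod

theorem iterate_ne [Finite V] {d : G.Dart} {n : ℕ} (h0 : 0 < n)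
    (h : n < R.faceLength (R.faceOf d)) : R.facePerm^[n] d ≠ d := by
  rw [← minimalPeriod_eq_faceLength] at h
  exact fun he => Function.not_isPeriodicPt_of_pos_of_lt_minimalPeriod h0.ne' h he

theorem exists_iterate_eq [Finite V] {d e : G.Dart} (h : R.faceOf e = R.faceOf d) :
    ∃ n < R.faceLength (R.faceOf d), e = R.facePerm^[n] d := by
  classical
  have := Fintype.ofFinite V
  obtain ⟨n, _, hn⟩ := (R.faceOf_eq_iff.1 h.symm).exists_pow_eq'
  rw [← minimalPeriod_eq_faceLength]
  refine ⟨n % Function.minimalPeriod R.facePerm d, Nat.mod_lt _ ?_, ?_⟩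
  · exact Function.minimalPeriod_pos_of_mem_periodicPts
      (Function.Injective.mem_periodicPts R.facePerm.injective d)
  · rw [Function.iterate_mod_minimalPeriod_eq, ← hn, Equiv.Perm.iterate_eq_pow]

theorem rot_rot_rot [Fintype V] [DecidableRel G.Adj] (hG : G.IsRegularOfDegree 3) (d : G.Dart) :
    R.rot (R.rot (R.rot d)) = d := by
  classical
  have h := MulAction.minimalPeriod_eq_card (a := R.rot) (b := d)
  have hset : (MulAction.orbit (Subgroup.zpowers R.rot) d).toFinset =
      Finset.univ.filter fun e : G.Dart => e.fst = d.fst := by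
    ext e
    rw [Set.mem_toFinset, Finset.mem_filter]
    constructor
    · rintro ⟨⟨_, i, rfl⟩, rfl⟩
      refine ⟨Finset.mem_univ _, ?_⟩
      have hs : R.rot.SameCycle d ((R.rot ^ i) d) := ⟨i, rfl⟩
      obtain ⟨n, -, hn⟩ := hs.exists_pow_eq'
      change ((R.rot ^ i) d).fst = d.fst
      rw [← hn]
      clear hn
      induction n with
      | zero => rfl
      | succ n ih => rw [pow_succ', Equiv.Perm.mul_apply, R.rot_fst, ih]
    · rintro ⟨-, he⟩
      obtain ⟨i, rfl⟩ := R.rot_sameCycle d e he.symm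
      exact ⟨⟨R.rot ^ i, i, rfl⟩, rfl⟩
  rw [← Set.toFinset_card, hset, G.dart_fst_fiber_card_eq_degree, hG d.fst] at h
  have h3 := Function.iterate_minimalPeriod (f := (R.rot • ·)) (x := d)
  rw [h] at h3
  exact h3

/-- Counting darts gives `2E = 3V` and `6F - 2E` pentagons; `V - E + F = 2` makes this number 12. -/
theorem ncard_five_faces [Fintype V] [DecidableRel G.Adj] (h : R.IsFullerene) :
    {f : R.Face | R.faceLength f = 5}.ncard = 12 := by
  classical
  have : Finite R.Face := Quotient.finite _
  have := Fintype.ofFinite R.Face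
  have hD : Fintype.card G.Dart = ∑ f : R.Face, R.faceLength f := by
    rw [← Finset.card_univ, Finset.card_eq_sum_card_fiberwise
      (f := R.faceOf) (t := Finset.univ) (fun _ _ => Finset.mem_univ _)]
    refine Finset.sum_congr rfl fun f _ => ?_
    rw [faceLength, Set.ncard_eq_toFinset_card']
    congr 1
    ext; simp
  have hE := G.dart_card_eq_twice_card_edges
  have hV := G.dart_card_eq_sum_degrees
  have hl : ∑ f : R.Face, (R.faceLength f + if R.faceLength f = 5 then 1 else 0) =
      ∑ f : R.Face, 6 := by
    refine Finset.sum_congr rfl fun f _ => ?_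
    rcases h.faceLength_eq f with hf | hf <;> simp [hf]
  rw [Finset.sum_add_distrib, ← hD, Finset.sum_boole] at hl
  simp only [h.cubic.degree_eq, Finset.sum_const, Finset.card_univ, smul_eq_mul] at hV hl
  have he := h.plane.2
  rw [Nat.card_eq_fintype_card, Nat.card_eq_fintype_card, Nat.card_eq_fintype_card,
    ← SimpleGraph.edgeFinset_card] at he
  rw [Set.ncard_eq_toFinset_card', Set.toFinset_ofPred]
  push_cast at hl
  lia

/-- Every vertex has degree dividing three: the cube of the rotation is the identity. -/
def IsCubic : Prop := ∀ d : G.Dart, R.rot (R.rot (R.rot d)) = d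

/-- A bi-infinite sequence of darts that runs along the outer boundary of a ring of faces, each
contributing two darts `p i` and `R.facePerm (p i)` to that boundary. -/
def IsRing (p : ℤ → G.Dart) : Prop :=
  ∀ i, R.facePerm (p (i + 1)).symm = (R.facePerm (p i)).symm

/-- The outer boundaries of the successive rings of faces around the face of the dart `x`, if
that face is surrounded by pentagons and then by hexagons. -/
def ringDart (x : G.Dart) : ℕ → ℤ → G.Dart
  | 0, i => R.facePerm (R.facePerm ((R.facePerm ^ i) x).symm)
  | n + 1, i => R.facePerm (R.facePerm (R.facePerm (ringDart x n i).symm))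

variable {R}

/-! ### Local identities at cubic vertices, and propagation of rings -/

theorem IsCubic.facePerm_symm (hR : R.IsCubic) (d : G.Dart) :
    R.facePerm (R.facePerm (R.facePerm d.symm).symm).symm = d := by
  simpa [facePerm_apply] using hR d

theorem IsCubic.facePerm_symm' (hR : R.IsCubic) (d : G.Dart) :
    R.facePerm (R.facePerm (R.facePerm d).symm).symm = d.symm := by
  simpa using hR.facePerm_symm d.symm

/-- `b` and `b'` are inner darts of consecutive faces of a ring. Locating `c` backwards from `b`
avoids any assumption on the face lengths. -/
theorem IsCubic.facePerm_symm_eq (hR : R.IsCubic) {b b' c : G.Dart}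
    (hb : R.facePerm b' = (R.facePerm b.symm).symm) (hc : R.facePerm (R.facePerm c) = b) :
    R.facePerm (R.facePerm b') = (R.facePerm c).symm := by
  have h := hR.facePerm_symm b
  rw [← hb, ← hc] at h
  rw [← R.facePerm.injective h, SimpleGraph.Dart.symm_symm]

theorem IsCubic.facePerm_symm_eq' (hR : R.IsCubic) {b b' c : G.Dart}
    (hb : R.facePerm b' = (R.facePerm b.symm).symm) (hc : R.facePerm (R.facePerm c) = b) :
    R.facePerm (R.facePerm (R.facePerm (R.facePerm b'))).symm = c.symm := by
  rw [hR.facePerm_symm_eq hb hc, hR.facePerm_symm']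

theorem IsRing.facePerm_symm_side (hR : R.IsCubic) {p : ℤ → G.Dart} (hp : R.IsRing p) (i : ℤ) :
    R.facePerm (R.facePerm (R.facePerm (p i))).symm = p (i + 1) := by
  have := hR.facePerm_symm (p (i + 1))
  rwa [hp i, SimpleGraph.Dart.symm_symm] at this

theorem IsRing.next (hR : R.IsCubic) {p : ℤ → G.Dart} (hp : R.IsRing p)
    (h6 : ∀ i, R.faceLength (R.faceOf (p i).symm) = 6) [Finite V] :
    R.IsRing fun i => R.facePerm (R.facePerm (R.facePerm (p i).symm)) := by
  intro i
  have h := R.iterate_faceLength (h6 i)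
  simp only [Function.iterate_succ, Function.iterate_zero, Function.comp_apply, id] at h
  exact hR.facePerm_symm_eq' (by rw [hp i, SimpleGraph.Dart.symm_symm]) h

theorem isRing_ringDart_zero (hR : R.IsCubic) {x : G.Dart} [Finite V]
    (h5 : ∀ d, R.faceOf d = R.faceOf x → R.faceLength (R.faceOf d.symm) = 5) :
    R.IsRing (R.ringDart x 0) := by
  intro i
  have h := R.iterate_faceLength (h5 _ (R.faceOf_facePerm_zpow i x))
  simp only [Function.iterate_succ, Function.iterate_zero, Function.comp_apply, id] at h
  simp only [ringDart]
  rw [add_comm, zpow_add, zpow_one, Equiv.Perm.mul_apply]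
  set y := (R.facePerm ^ i) x
  have h1 := hR.facePerm_symm y.symm
  rw [SimpleGraph.Dart.symm_symm] at h1
  replace h1 := h1.trans h.symm
  rw [SimpleGraph.Dart.symm_involutive.eq_iff.1 (R.facePerm.injective h1), hR.facePerm_symm']

theorem isRing_ringDart (hR : R.IsCubic) {x : G.Dart} [Finite V]
    (h5 : ∀ d, R.faceOf d = R.faceOf x → R.faceLength (R.faceOf d.symm) = 5) (n : ℕ)
    (h6 : ∀ m, 0 < m → m ≤ n → ∀ i, R.faceLength (R.faceOf (R.ringDart x m i)) = 6) :
    R.IsRing (R.ringDart x n) := by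
  induction n with
  | zero => exact isRing_ringDart_zero hR h5
  | succ n ih =>
    refine (ih fun m hm hmn => h6 m hm (by lia)).next hR fun i => ?_
    simpa [ringDart, faceOf_facePerm] using h6 (n + 1) (by lia) le_rfl i

open SimpleGraph.Dart (symm_symm)

/-! ### Rings do not fold back -/

theorem IsRing.symm_eq_succ {p q : ℤ → G.Dart} (hp : R.IsRing p) (hq : R.IsRing q) {i j : ℤ}
    (h : (p i).symm = q j) : (p (i + 1)).symm = q (j - 1) := by
  have h1 := hp i
  have h2 := hq (j - 1)
  rw [sub_add_cancel, ← h, symm_symm] at h2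
  rw [h2, symm_symm] at h1
  exact R.facePerm.injective h1

theorem IsRing.symm_eq_pred {p q : ℤ → G.Dart} (hp : R.IsRing p) (hq : R.IsRing q) {i j : ℤ}
    (h : (p i).symm = q j) : (p (i - 1)).symm = q (j + 1) := by
  rw [← hq.symm_eq_succ hp (i := j) (j := i) (by rw [← h, symm_symm]), symm_symm]

theorem IsRing.symm_eq_add {p q : ℤ → G.Dart} (hp : R.IsRing p) (hq : R.IsRing q) {i j : ℤ}
    (h : (p i).symm = q j) (t : ℤ) : (p (i + t)).symm = q (j - t) := by
  induction t using Int.induction_on with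
  | zero => simpa using h
  | succ t ih =>
    have := hp.symm_eq_succ hq ih
    rwa [add_assoc, sub_sub] at this
  | pred t ih =>
    have := hp.symm_eq_pred hq ih
    rwa [add_sub_assoc, sub_add] at this

/-- If two boundary darts were glued, the gluing would spread with one index rising and the other
falling. At the midpoint a dart would equal its own reverse. -/
theorem IsRing.symm_ne {p : ℤ → G.Dart} (hp : R.IsRing p) (i j : ℤ) : (p i).symm ≠ p j := by
  intro h
  obtain ⟨d, hd⟩ := Int.even_or_odd' (i + j)
  have h' := hp.symm_eq_add hp h (d - i)
  rw [add_sub_cancel] at h'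
  rcases hd with hd | hd
  · rw [show j - (d - i) = d by lia] at h'
    exact SimpleGraph.Dart.symm_ne _ h'
  · rw [show j - (d - i) = d + 1 by lia] at h'
    have h1 := hp d
    rw [← h', symm_symm] at h1
    exact SimpleGraph.Dart.symm_ne _ h1.symm

theorem IsRing.next_symm_ne [Finite V] (hR : R.IsCubic) {p q : ℤ → G.Dart} (hp : R.IsRing p)
    (hq : R.IsRing q) (hpq : ∀ i, q i = R.facePerm (R.facePerm (R.facePerm (p i).symm)))
    (h6 : ∀ i, R.faceLength (R.faceOf (q i)) = 6) (i j : ℤ) : (q i).symm ≠ p j := by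
  intro h
  obtain ⟨d, hd⟩ := Int.even_or_odd' (i + j)
  have h' := hq.symm_eq_add hp h (d - i)
  rw [add_sub_cancel] at h'
  have h3 := hpq (j - (d - i))
  rw [← h', symm_symm] at h3
  rcases hd with hd | hd
  · rw [show j - (d - i) = d by lia] at h3
    exact R.iterate_ne (n := 3) (by simp) (by rw [h6 d]; simp) h3.symm
  · rw [show j - (d - i) = d + 1 by lia, ← hq.facePerm_symm_side hR d] at h3
    exact SimpleGraph.Dart.symm_ne _ (R.facePerm.injective h3)

section

variable [Finite V] (hR : R.IsCubic) {x : G.Dart}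
  (h5 : ∀ d, R.faceOf d = R.faceOf x → R.faceLength (R.faceOf d.symm) = 5)

include hR h5

theorem ringDart_symm_ne {m n : ℕ} (hnm : n ≤ m)
    (h6 : ∀ k, 0 < k → k ≤ m → ∀ i, R.faceLength (R.faceOf (R.ringDart x k i)) = 6)
    (i j : ℤ) : (R.ringDart x m i).symm ≠ R.ringDart x n j := by
  induction m using Nat.strong_induction_on generalizing n with
  | _ m ih =>
  have hring : ∀ k ≤ m, R.IsRing (R.ringDart x k) := fun k hk =>
    isRing_ringDart hR h5 k fun l hl hlk => h6 l hl (hlk.trans hk)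
  rcases Nat.eq_or_lt_of_le hnm with rfl | hlt
  · exact (hring n le_rfl).symm_ne i j
  rcases Nat.eq_or_lt_of_le (Nat.succ_le_of_lt hlt) with rfl | hlt'
  · exact (hring n (by lia)).next_symm_ne hR (hring _ le_rfl) (fun _ => rfl)
      (h6 _ (by lia) le_rfl) i j
  · intro h
    -- Crossing the hexagons on both sides to their opposite edges brings the two ring indices
    -- closer: from `m + 1`, `n` to `m`, `n + 1`.
    obtain ⟨m, rfl⟩ : ∃ m', m = m' + 1 := ⟨m - 1, by lia⟩
    refine ih m (by lia) (n := n + 1) (by lia) (fun k hk hkm => h6 k hk (by lia)) ?_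
    have h1 := R.iterate_faceLength (h6 (m + 1) (by lia) le_rfl i)
    simp only [Function.iterate_succ, Function.iterate_zero, Function.comp_apply, id] at h1
    have h2 : R.ringDart x (n + 1) j =
        R.facePerm (R.facePerm (R.facePerm (R.ringDart x (m + 1) i))) := by
      rw [ringDart, ← h, symm_symm]
    rw [h2]
    have h3 : R.ringDart x (m + 1) i =
      R.facePerm (R.facePerm (R.facePerm (R.ringDart x m i).symm)) := rfl
    nth_rewrite 2 [h3] at h1
    exact (R.facePerm.injective (R.facePerm.injective (R.facePerm.injective h1))).symm

omit [Finite V] hR in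
theorem faceLength_ringDart_zero (i : ℤ) : R.faceLength (R.faceOf (R.ringDart x 0 i)) = 5 := by
  simpa [ringDart, faceOf_facePerm] using h5 _ (R.faceOf_facePerm_zpow i x)

omit [Finite V] hR h5 in
theorem faceOf_ringDart_symm (m : ℕ) (i : ℤ) :
    R.faceOf (R.ringDart x m i).symm = R.faceOf (R.ringDart x (m + 1) i) := by
  simp [ringDart, faceOf_facePerm]

omit [Finite V] hR h5 in
theorem IsRing.faceOf_symm_facePerm {m : ℕ} (h : R.IsRing (R.ringDart x m)) (i : ℤ) :
    R.faceOf (R.facePerm (R.ringDart x m i)).symm = R.faceOf (R.ringDart x (m + 1) (i + 1)) := by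
  rw [← h i, faceOf_facePerm, faceOf_ringDart_symm]

omit [Finite V] h5 in
theorem IsRing.faceOf_symm_side {p : ℤ → G.Dart} (h : R.IsRing p) (i : ℤ) :
    R.faceOf (R.facePerm (R.facePerm (p i))).symm = R.faceOf (p (i + 1)) := by
  rw [← h.facePerm_symm_side hR, faceOf_facePerm]

omit [Finite V] h5 in
theorem IsRing.symm_of_facePerm_eq {p : ℤ → G.Dart} (h : R.IsRing p) {i : ℤ} {e : G.Dart}
    (he : R.facePerm e = p i) : e.symm = R.facePerm (R.facePerm (p (i - 1))) := by
  have h1 := h.facePerm_symm_side hR (i - 1)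
  rw [sub_add_cancel, ← he] at h1
  rw [← R.facePerm.injective h1, symm_symm]

omit [Finite V] h5 in
theorem IsRing.faceOf_symm_of_facePerm_eq {p : ℤ → G.Dart} (h : R.IsRing p) {i : ℤ}
    {e : G.Dart} (he : R.facePerm e = p i) : R.faceOf e.symm = R.faceOf (p (i - 1)) := by
  rw [h.symm_of_facePerm_eq hR he, faceOf_facePerm, faceOf_facePerm]

/-- An inner dart of the new face would be one of the five darts of a ring 0 pentagon. The edge to
`F`, the two sides and the two outer edges are excluded in turn. -/
theorem faceOf_ringDart_succ_ne {m : ℕ} (hx6 : R.faceLength (R.faceOf x) = 6)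
    (hinj : ∀ d e, R.faceOf d = R.faceOf x → R.faceOf e = R.faceOf x →
      R.faceOf d.symm = R.faceOf e.symm → d = e)
    (h6 : ∀ k, 0 < k → k ≤ m → ∀ i, R.faceLength (R.faceOf (R.ringDart x k i)) = 6)
    (i j : ℤ) : R.faceOf (R.ringDart x (m + 1) i) ≠ R.faceOf (R.ringDart x 0 j) := by
  have hm := isRing_ringDart hR h5 m h6
  have h0 := isRing_ringDart_zero hR h5
  have hl0 := faceLength_ringDart_zero h5
  -- For `m > 0` the lengths 6 and 5 differ; for `m = 0` the pentagons around `F` are distinct.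
  have key : ∀ i j, R.faceOf (R.ringDart x m i) = R.faceOf (R.ringDart x 0 j) →
      R.ringDart x m i = R.ringDart x 0 j := by
    intro i j h
    rcases Nat.eq_zero_or_pos m with rfl | hpos
    · simp only [ringDart, faceOf_facePerm] at h
      simp only [ringDart]
      rw [hinj _ _ (R.faceOf_facePerm_zpow i x) (R.faceOf_facePerm_zpow j x) h]
    · have := h6 m hpos le_rfl i
      rw [h, hl0] at this
      simp at this
  have hne1 : ∀ j, R.facePerm (R.ringDart x 0 j) ≠ R.ringDart x 0 j := fun j =>
    R.iterate_ne (n := 1) (by simp) (by rw [hl0]; simp)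
  have hne2 : ∀ j, R.facePerm (R.facePerm (R.ringDart x 0 j)) ≠ R.ringDart x 0 j := fun j =>
    R.iterate_ne (n := 2) (by simp) (by rw [hl0]; simp)
  intro h
  rw [← faceOf_ringDart_symm] at h
  have ha : R.faceOf (R.ringDart x 0 j) = R.faceOf ((R.facePerm ^ j) x).symm := by
    simp [ringDart, faceOf_facePerm]
  rw [ha] at h
  obtain ⟨n, hn, hd⟩ := R.exists_iterate_eq h
  rw [← ha, hl0] at hn
  interval_cases n <;>
    simp only [Function.iterate_succ, Function.iterate_zero, Function.comp_apply, id] at hd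
  · have hx : R.faceOf (R.ringDart x m i) = R.faceOf x := by
      rw [SimpleGraph.Dart.symm_involutive.injective hd, faceOf_facePerm_zpow]
    have h1 := h5 (R.facePerm (R.facePerm (R.ringDart x m i)))
      (by rw [faceOf_facePerm, faceOf_facePerm, hx])
    rw [hm.faceOf_symm_side hR] at h1
    rcases Nat.eq_zero_or_pos m with rfl | hpos
    · rw [← hx, hl0] at hx6
      simp at hx6
    · rw [h6 m hpos le_rfl] at h1
      simp at h1
  · have h1 := h0.symm_of_facePerm_eq hR (i := j) (congrArg R.facePerm hd)
    rw [symm_symm] at h1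
    have h2 := key i (j - 1) (by rw [h1, faceOf_facePerm, faceOf_facePerm])
    exact hne2 _ (h1.symm.trans h2)
  · exact ringDart_symm_ne hR h5 (Nat.zero_le m) h6 i j hd
  · have h1 := hm (i - 1)
    rw [sub_add_cancel, hd] at h1
    have h2 : R.facePerm (R.ringDart x m (i - 1)) =
        (R.facePerm (R.facePerm (R.ringDart x 0 j))).symm := by
      rw [ringDart, h1, symm_symm]
    have h3 := congrArg R.facePerm h2
    rw [h0.facePerm_symm_side hR] at h3
    have h4 := key (i - 1) (j + 1) (by rw [← h3, faceOf_facePerm, faceOf_facePerm])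
    rw [h4] at h3
    exact hne2 _ h3
  · have h1 : R.facePerm (R.ringDart x m i) = R.ringDart x 0 (j + 1) := by
      rw [← h0.facePerm_symm_side hR, ringDart, ← hd, symm_symm]
    have h2 := key i (j + 1) (by rw [← h1, faceOf_facePerm])
    rw [h2] at h1
    exact hne1 _ h1

theorem faceOf_symm_of_faceOf_eq_ringDart {m : ℕ}
    (h6 : ∀ k, 0 < k → k ≤ m → ∀ i, R.faceLength (R.faceOf (R.ringDart x k i)) = 6)
    {d : G.Dart} {i : ℤ} (hd : R.faceOf d = R.faceOf (R.ringDart x m i)) :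
    R.faceOf d.symm = R.faceOf x ∨
      ∃ m' ≤ m + 1, ∃ j, R.faceOf d.symm = R.faceOf (R.ringDart x m' j) := by
  have hm := isRing_ringDart hR h5 m h6
  cases m with
  | zero =>
    have ha : R.faceOf (R.ringDart x 0 i) = R.faceOf ((R.facePerm ^ i) x).symm := by
      simp [ringDart, faceOf_facePerm]
    obtain ⟨n, hn, rfl⟩ := R.exists_iterate_eq (hd.trans ha)
    rw [← ha, faceLength_ringDart_zero h5] at hn
    interval_cases n <;>
      simp only [Function.iterate_succ, Function.iterate_zero, Function.comp_apply, id]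
    · exact Or.inl (by rw [symm_symm, faceOf_facePerm_zpow])
    · exact Or.inr ⟨0, by lia, _, hm.faceOf_symm_of_facePerm_eq hR (i := i) rfl⟩
    · exact Or.inr ⟨1, by lia, _, faceOf_ringDart_symm 0 i⟩
    · exact Or.inr ⟨1, by lia, _, hm.faceOf_symm_facePerm i⟩
    · exact Or.inr ⟨0, by lia, _, hm.faceOf_symm_side hR i⟩
  | succ m =>
    have hm' := isRing_ringDart hR h5 m fun k hk hkm => h6 k hk (by lia)
    rw [← faceOf_ringDart_symm] at hd
    obtain ⟨n, hn, rfl⟩ := R.exists_iterate_eq hd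
    rw [faceOf_ringDart_symm, h6 _ (by lia) le_rfl] at hn
    interval_cases n <;>
      simp only [Function.iterate_succ, Function.iterate_zero, Function.comp_apply, id]
    · exact Or.inr ⟨m, by lia, i, by rw [symm_symm]⟩
    · refine Or.inr ⟨m, by lia, i - 1, ?_⟩
      have := hm' (i - 1)
      rw [sub_add_cancel] at this
      rw [this, symm_symm, faceOf_facePerm]
    · exact Or.inr ⟨m + 1, by lia, _, hm.faceOf_symm_of_facePerm_eq hR (i := i) rfl⟩
    · exact Or.inr ⟨m + 2, by lia, _, faceOf_ringDart_symm (m + 1) i⟩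
    · exact Or.inr ⟨m + 2, by lia, _, hm.faceOf_symm_facePerm i⟩
    · exact Or.inr ⟨m + 1, by lia, _, hm.faceOf_symm_side hR i⟩

/-! ### Rings and facial distance -/

omit [Finite V] hR h5 in
theorem dist_faceOf_symm_le (hc : R.dual.Connected) (f : R.Face) (d : G.Dart) :
    R.dual.dist f (R.faceOf d.symm) ≤ R.dual.dist f (R.faceOf d) + 1 := by
  by_cases h : R.faceOf d = R.faceOf d.symm
  · rw [h]; lia
  · have := hc.dist_triangle (u := f) (v := R.faceOf d) (w := R.faceOf d.symm)
    rwa [SimpleGraph.dist_eq_one_iff_adj.2 (R.dual_adj_of_ne h)] at this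

omit [Finite V] hR h5 in
theorem dist_ringDart_le (hc : R.dual.Connected) (m : ℕ) (i : ℤ) :
    R.dual.dist (R.faceOf x) (R.faceOf (R.ringDart x m i)) ≤ m + 1 := by
  induction m with
  | zero =>
    have := dist_faceOf_symm_le hc (R.faceOf x) ((R.facePerm ^ i) x)
    rw [faceOf_facePerm_zpow, SimpleGraph.dist_self] at this
    simpa [ringDart, faceOf_facePerm] using this
  | succ m ih =>
    rw [← faceOf_ringDart_symm]
    exact (dist_faceOf_symm_le hc _ _).trans (by lia)

theorem exists_ringDart_of_dist (hc : R.dual.Connected) {n : ℕ}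
    (h6 : ∀ k, 0 < k → k + 1 < n → ∀ i, R.faceLength (R.faceOf (R.ringDart x k i)) = 6)
    {f : R.Face} (hf : R.dual.dist (R.faceOf x) f = n) :
    f = R.faceOf x ∨ ∃ m < n, ∃ i, f = R.faceOf (R.ringDart x m i) := by
  induction n generalizing f with
  | zero => exact Or.inl (hc.dist_eq_zero_iff.1 hf).symm
  | succ n ih =>
    obtain ⟨w, hw⟩ := hc.exists_walk_length_eq_dist f (R.faceOf x)
    rw [SimpleGraph.dist_comm, hf] at hw
    cases w with
    | nil => simp at hw
    | @cons _ g _ hfg w =>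
      have h1 : R.dual.dist (R.faceOf x) g = n := by
        have h2 := SimpleGraph.dist_le w
        have h3 := hc.dist_triangle (u := R.faceOf x) (v := g) (w := f)
        rw [SimpleGraph.dist_eq_one_iff_adj.2 hfg.symm] at h3
        rw [SimpleGraph.dist_comm] at h2
        rw [SimpleGraph.Walk.length_cons] at hw
        lia
      obtain ⟨-, d, rfl, rfl⟩ := hfg.symm
      rcases ih (fun k hk hkn => h6 k hk (by lia)) h1 with h | ⟨m, hm, i, hi⟩
      · obtain ⟨i, rfl⟩ := R.faceOf_eq_iff.1 h.symm
        exact Or.inr ⟨0, by lia, i, by simp [ringDart, faceOf_facePerm]⟩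
      · rcases faceOf_symm_of_faceOf_eq_ringDart hR h5
          (fun k hk hkm => h6 k hk (by lia)) hi with h | ⟨m', hm', j, hj⟩
        · exact Or.inl h
        · exact Or.inr ⟨m', by lia, j, hj⟩

/-- A pentagon of the last ring has a single outer edge. Consecutive faces of the ring share the
outer face at their common corner, so if one touches `F'` across its outer edge, so does the next,
which is then a pentagon too. -/
theorem faceLength_ringDart_succ_eq_five {n : ℕ} {F' : R.Face}
    (h6 : ∀ k, 0 < k → k ≤ n → ∀ i, R.faceLength (R.faceOf (R.ringDart x k i)) = 6)
    (h5' : ∀ d, R.faceOf d.symm = F' → R.faceLength (R.faceOf d) = 5)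
    (hne : ∀ m ≤ n + 1, ∀ i, R.faceOf (R.ringDart x m i) ≠ F') {d : G.Dart} {j : ℤ}
    (hd : R.faceOf d = R.faceOf (R.ringDart x (n + 1) j)) (hd' : R.faceOf d.symm = F') (i : ℤ) :
    R.faceLength (R.faceOf (R.ringDart x (n + 1) i)) = 5 := by
  have hn := isRing_ringDart hR h5 n h6
  have hb : ∀ i, R.facePerm (R.ringDart x n (i + 1)).symm =
      (R.facePerm (R.ringDart x n i).symm.symm).symm := fun i => by rw [hn i, symm_symm]
  have hper : ∀ i, R.faceLength (R.faceOf (R.ringDart x (n + 1) i)) = 5 →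
      R.facePerm (R.facePerm (R.ringDart x (n + 1) i)) = (R.ringDart x n i).symm := by
    intro i hi
    rw [← faceOf_ringDart_symm] at hi
    exact R.iterate_faceLength hi
  have hiff : ∀ i, R.faceOf (R.ringDart x (n + 1) (i + 1)).symm = F' ↔
      R.faceOf (R.ringDart x (n + 1) i).symm = F' := by
    intro i
    -- `c` is the outer dart of face `i` at its corner with face `i + 1`; it is `R.ringDart x (n +
    -- 1) i` when face `i` is a pentagon.
    obtain ⟨c, hc⟩ : ∃ c, R.facePerm (R.facePerm c) = (R.ringDart x n i).symm :=
      ⟨R.facePerm.symm (R.facePerm.symm (R.ringDart x n i).symm), by simp⟩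
    have h1 : R.facePerm (R.ringDart x (n + 1) (i + 1)).symm = c.symm :=
      hR.facePerm_symm_eq' (hb i) hc
    rw [← R.faceOf_facePerm, h1]
    have hcf : R.faceOf c = R.faceOf (R.ringDart x (n + 1) i) := by
      rw [← faceOf_ringDart_symm, ← hc, faceOf_facePerm, faceOf_facePerm]
    have heq : R.faceLength (R.faceOf (R.ringDart x (n + 1) i)) = 5 →
        c = R.ringDart x (n + 1) i := fun h =>
      R.facePerm.injective (R.facePerm.injective (hc.trans (hper i h).symm))
    constructor
    · intro h
      rw [← heq (hcf ▸ h5' _ h), h]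
    · intro h
      rw [heq (h5' _ h), h]
  suffices h : R.faceOf (R.ringDart x (n + 1) j).symm = F' by
    refine h5' _ ?_
    obtain ⟨t, rfl⟩ : ∃ t, i = j + t := ⟨i - j, by lia⟩
    induction t using Int.induction_on with
    | zero => simpa using h
    | succ t ih => rwa [← add_assoc, hiff]
    | pred t ih => rwa [← hiff, ← add_sub_assoc, sub_add_cancel]
  have hlen : R.faceLength (R.faceOf (R.ringDart x (n + 1) j)) = 5 := hd ▸ h5' d hd'
  have hd1 := hd
  rw [← faceOf_ringDart_symm] at hd1
  obtain ⟨t, ht, rfl⟩ := R.exists_iterate_eq hd1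
  rw [faceOf_ringDart_symm, hlen] at ht
  interval_cases t <;>
    simp only [Function.iterate_succ, Function.iterate_zero, Function.comp_apply, id] at hd'
  · rw [symm_symm] at hd'
    exact absurd hd' (hne n (by lia) j)
  · have := hn (j - 1)
    rw [sub_add_cancel] at this
    rw [this, symm_symm, faceOf_facePerm] at hd'
    exact absurd hd' (hne n (by lia) _)
  · have h1 := hb (j - 1)
    rw [sub_add_cancel] at h1
    have h2 := hR.facePerm_symm_eq h1
      (c := R.facePerm.symm (R.facePerm.symm (R.ringDart x n (j - 1)).symm)) (by simp)
    rw [h2, symm_symm, faceOf_facePerm, ← R.faceOf_facePerm, ← R.faceOf_facePerm,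
      Equiv.apply_symm_apply, Equiv.apply_symm_apply, faceOf_ringDart_symm] at hd'
    exact absurd hd' (hne (n + 1) le_rfl _)
  · exact hd'
  · have h2 := hR.facePerm_symm_eq (hb j) (hper j hlen)
    simp only [ringDart] at h2
    rw [← h2, faceOf_facePerm, faceOf_facePerm, faceOf_ringDart_symm] at hd'
    exact absurd hd' (hne (n + 1) le_rfl _)

end

/-! ### Pentagons of a drum, and the conclusion -/

/-- Six darts must reach six pentagons, so crossing the edges of `F` is a bijection onto them. -/
theorem symm_faceOf_of_fiveFacesAround [Finite V] {F : R.Face} (h6 : R.faceLength F = 6)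
    (hc : (R.fiveFacesAround F).ncard = 6) :
    (∀ d, R.faceOf d = F → R.faceOf d.symm ∈ R.fiveFacesAround F) ∧
      ∀ d e, R.faceOf d = F → R.faceOf e = F → R.faceOf d.symm = R.faceOf e.symm → d = e := by
  have : Finite G.Dart := by
    classical
    have := Fintype.ofFinite V
    infer_instance
  set S : Set G.Dart := {d | R.faceOf d = F}
  have hS : S.ncard = 6 := h6
  have hsub : R.fiveFacesAround F ⊆ (fun d : G.Dart => R.faceOf d.symm) '' S := by
    rintro f ⟨⟨-, d, hd, hd'⟩, -⟩
    exact ⟨d, hd, hd'⟩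
  have hle : ((fun d : G.Dart => R.faceOf d.symm) '' S).ncard ≤ S.ncard :=
    Set.ncard_image_le S.toFinite
  have heq := Set.eq_of_subset_of_ncard_le hsub (by lia) (S.toFinite.image _)
  refine ⟨fun d hd => heq ▸ Set.mem_image_of_mem _ hd, fun d e hd he h => ?_⟩
  exact Set.injOn_of_ncard_image_eq (by rw [← heq, hc, hS]) S.toFinite hd he h

theorem IsDrum.adj_or_adj [Fintype V] [DecidableRel G.Adj] {F F' : R.Face} (h : R.IsDrum F F')
    {f : R.Face} (hf : R.faceLength f = 5) : R.dual.Adj F f ∨ R.dual.Adj F' f := by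
  have : Finite R.Face := Quotient.finite _
  have hsub : R.fiveFacesAround F ∪ R.fiveFacesAround F' ⊆ {f : R.Face | R.faceLength f = 5} := by
    rintro f (hf | hf) <;> exact hf.2
  have heq := Set.eq_of_subset_of_ncard_le hsub (by
    rw [Set.ncard_union_eq h.disjoint, h.card_left, h.card_right, ncard_five_faces R h.fullerene])
  have hf' : f ∈ {f : R.Face | R.faceLength f = 5} := hf
  rw [← heq] at hf'
  exact hf'.imp And.left And.left

theorem IsKDrum.faceLength_eq [Fintype V] [DecidableRel G.Adj] {k : ℕ} {F F' : R.Face}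
    (h : R.IsKDrum k F F') {l : ℕ} (h0 : 0 < l) (hl : l ≤ k) {f : R.Face}
    (hf : R.dual.dist F f = l) : R.faceLength f = if l = 1 ∨ l = k then 5 else 6 := by
  obtain ⟨x, rfl⟩ := R.faceOf_surjective F
  have hD := h.drum
  have hk : R.dual.dist (R.faceOf x) F' = k + 1 := h.dist_eq
  have hc : R.dual.Connected :=
    { preconnected := R.dual_preconnected hD.fullerene.plane.1, nonempty := ⟨F'⟩ }
  have hR : R.IsCubic := R.rot_rot_rot hD.fullerene.cubic
  obtain ⟨hF, hinj⟩ := symm_faceOf_of_fiveFacesAround hD.length_left hD.card_left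
  obtain ⟨hF', -⟩ := symm_faceOf_of_fiveFacesAround hD.length_right hD.card_right
  have h5 : ∀ d, R.faceOf d = R.faceOf x → R.faceLength (R.faceOf d.symm) = 5 :=
    fun d hd => (hF d hd).2
  have h5' : ∀ d, R.faceOf d.symm = F' → R.faceLength (R.faceOf d) = 5 := fun d hd => by
    simpa using (hF' d.symm hd).2
  by_cases h1 : l = 1
  · subst h1
    rw [if_pos (Or.inl rfl)]
    obtain ⟨-, d, hd, rfl⟩ := SimpleGraph.dist_eq_one_iff_adj.1 hf
    exact h5 d hd
  have hadj' : ∀ g, R.dual.Adj F' g → k ≤ R.dual.dist (R.faceOf x) g := by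
    intro g hg
    have := hc.dist_triangle (u := R.faceOf x) (v := g) (w := F')
    rw [SimpleGraph.dist_eq_one_iff_adj.2 hg.symm] at this
    lia
  by_cases hlk : l = k
  · subst hlk
    rw [if_pos (Or.inr rfl)]
    have hhex : ∀ m, 0 < m → m + 1 < l → ∀ i, R.faceLength (R.faceOf (R.ringDart x m i)) = 6 := by
      intro m
      induction m using Nat.strong_induction_on with
      | _ m ih =>
      intro hm hml i
      refine (hD.fullerene.faceLength_eq _).resolve_left fun hlen => ?_
      rcases hD.adj_or_adj hlen with ha | ha
      · obtain ⟨m, rfl⟩ : ∃ m', m = m' + 1 := ⟨m - 1, by lia⟩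
        obtain ⟨-, d, hd, hd'⟩ := ha
        obtain ⟨j, rfl⟩ := R.faceOf_eq_iff.1 hd.symm
        refine faceOf_ringDart_succ_ne (m := m) hR h5 hD.length_left hinj
          (fun n hn hnm => ih n (by lia) hn (by lia)) i j ?_
        rw [← hd']
        simp [ringDart, faceOf_facePerm]
      · have := hadj' _ ha
        have := dist_ringDart_le (x := x) hc m i
        lia
    have hcov : ∀ g, R.dual.dist (R.faceOf x) g = l →
        -- Here `l ≥ 2`, so `l - 2 + 1` is `l - 1` written as a successor.
        ∃ i, g = R.faceOf (R.ringDart x (l - 2 + 1) i) := by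
      intro g hg
      rcases exists_ringDart_of_dist hR h5 hc hhex hg with rfl | ⟨m, hm, i, rfl⟩
      · rw [SimpleGraph.dist_self] at hg
        lia
      · have := dist_ringDart_le (x := x) hc m i
        exact ⟨i, by rw [show m = l - 2 + 1 by lia]⟩
    obtain ⟨g, hg, hgF⟩ : ∃ g, R.dual.dist (R.faceOf x) g = l ∧ R.dual.Adj g F' := by
      obtain ⟨w, hw⟩ := hc.exists_walk_length_eq_dist F' (R.faceOf x)
      rw [SimpleGraph.dist_comm, hk] at hw
      cases w with
      | nil => simp at hw
      | @cons _ g _ hFg w =>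
        refine ⟨g, le_antisymm ?_ (hadj' g hFg), hFg.symm⟩
        rw [SimpleGraph.Walk.length_cons] at hw
        rw [SimpleGraph.dist_comm]
        exact (SimpleGraph.dist_le w).trans (by lia)
    obtain ⟨-, d, hd, hd'⟩ := hgF
    obtain ⟨j, hj⟩ := hcov g hg
    obtain ⟨i, rfl⟩ := hcov f hf
    refine faceLength_ringDart_succ_eq_five hR h5 (fun m hm hml => hhex m hm (by lia)) h5' ?_
      (hd.trans hj) hd' i
    rintro m hm i rfl
    have := dist_ringDart_le (x := x) hc m i
    lia
  · rw [if_neg (by lia)]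
    refine (hD.fullerene.faceLength_eq _).resolve_left fun hlen => ?_
    rcases hD.adj_or_adj hlen with ha | ha
    · exact h1 (hf.symm.trans (SimpleGraph.dist_eq_one_iff_adj.2 ha))
    · have := hadj' _ ha
      lia

end RotationSystem

theorem mainTheorem7 {V : Type*} [Fintype V] (G : SimpleGraph V) [DecidableRel G.Adj]
    (R : RotationSystem G) (k : ℕ) (F F' : R.Face) (hdrum : R.IsKDrum k F F')
    (l : ℕ) (hl : l ≤ k) (f g : R.Face)
    (hf : R.facialDist F f = l) (hg : R.facialDist F g = l) :
    R.faceLength f = R.faceLength g := by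
  rcases Nat.eq_zero_or_pos l with rfl | h0
  · have hc : R.dual.Connected :=
      { preconnected := R.dual_preconnected hdrum.drum.fullerene.plane.1, nonempty := ⟨F⟩ }
    rw [← hc.dist_eq_zero_iff.1 hf, ← hc.dist_eq_zero_iff.1 hg]
  · rw [hdrum.faceLength_eq h0 hl hf, hdrum.faceLength_eq h0 hl hg]
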